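/- Let $\Bbbk$ be a field, $R=\Bbbk[x_1,\dots,x_d]$ with its $\mathbb{N}^d$-grading, $M\subseteq R$ a monomial ideal, and $\mathcal F:\ \cdots\to F_2\xrightarrow{d_2}F_1\xrightarrow{d_1}F_0$ a minimal multigraded free resolution of $R/M$, where $F_i=\bigoplus_{\mathbf b}R(-\mathbf b)^{\beta_{i,\mathbf b}}$ and the $\beta_{i,\mathbf b}=\beta_{i,\mathbf b}(R/M)$ are the multigraded Betti numbers of $R/M$. An *automorphism* of $\mathcal F$ is a family of multigraded (degree $0$) isomorphisms $f_i:F_i\to F_i$ such that $d_i'\circ f_i=f_{i-1}\circ d_i$ for every $i\ge 1$, where $\{d_i\}$ and $\{d_i'\}$ are representatives (matrices) of the differential of $\mathcal F$ with respect to two, possibly different, choices of multigraded bases of the $F_i$, ordered so that corresponding basis elements have the same multidegree. It is *trivial* if every $f_i$ is represented by a diagonal matrix with units of $\Bbbk$ along the diagonal. The lcm-lattice $\mathrm{LCM}(M)$ is the set of least common multiples of sets of minimal monomial generators of $M$ (with $1$ the lcm of the empty set), ordered by divisibility. The ideal $M$ is *rigid* if - (R1) $\beta_{i,\mathbf b}$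 is $0$ or $1$ for all $i$ and all multidegrees $\mathbf b$; and - (R2) if $\mathbf b\neq\mathbf b'$ and $\beta_{i,\mathbf b}=\beta_{i,\mathbf b'}=1$ for the same $i$, then $\mathbf{x}^{\mathbf b}$ and $\mathbf{x}^{\mathbf b'}$ are not comparable in $\mathrm{LCM}(M)$. **Proposition.** All automorphisms of the minimal free resolution $\mathcal F$ of $R/M$ are trivial if and only if $M$ is rigid. -/

import Mathlib

open MvPolynomial

/-- A monomial ideal of `k[x_1, …, x_d]`: an ideal generated by a set of monomials. -/
def IsMonomialIdeal {k : Type*} [Field k] {d : ℕ} (M : Ideal (MvPolynomial (Fin d) k)) : Prop :=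
  ∃ S : Set (Fin d →₀ ℕ), M = Ideal.span ((fun a => monomial a (1 : k)) '' S)

/-- The exponents of the minimal monomial generators `G(M)` of a monomial ideal: the monomials
of `M` that are minimal for divisibility (divisibility of monomials is the componentwise order
on exponents). -/
def minimalGenerators {k : Type*} [Field k] {d : ℕ} (M : Ideal (MvPolynomial (Fin d) k)) :
    Set (Fin d →₀ ℕ) :=
  {a | Minimal (fun a' => monomial a' (1 : k) ∈ M) a}

/-- The ground set of the lcm-lattice of `M`: exponents of the least common multiples of the
sets of minimal generators, the empty set having the lcm `1` (exponent `0`).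
Its order is the one induced from `ℕ^d`, that is, divisibility. -/
def lcmLattice {k : Type*} [Field k] {d : ℕ} (M : Ideal (MvPolynomial (Fin d) k)) :
    Set (Fin d →₀ ℕ) :=
  {b | ∃ S : Finset (Fin d →₀ ℕ), (S : Set (Fin d →₀ ℕ)) ⊆ minimalGenerators M ∧ b = S.sup id}

/-- For shifts `a_1, …, a_r`, the vector `v` is a homogeneous element of multidegree `b` of the
multigraded free module `R(-a_1) ⊕ ⋯ ⊕ R(-a_r)`, whose `j`-th standard basis vector has
multidegree `a_j`. -/
def IsHomogeneousVec {k : Type*} [Field k] {d r : ℕ} (a : Fin r → (Fin d →₀ ℕ))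
    (b : Fin d →₀ ℕ) (v : Fin r → MvPolynomial (Fin d) k) : Prop :=
  ∀ j, ∀ m ∈ (v j).support, a j + m = b

/-- A linear map between multigraded free modules that preserves multidegrees
(is multigraded of degree `0`). -/
def IsDegreeZero {k : Type*} [Field k] {d r s : ℕ} (a : Fin r → (Fin d →₀ ℕ))
    (a' : Fin s → (Fin d →₀ ℕ))
    (f : (Fin r → MvPolynomial (Fin d) k) →ₗ[MvPolynomial (Fin d) k]
      (Fin s → MvPolynomial (Fin d) k)) : Prop :=
  ∀ b v, IsHomogeneousVec a b v → IsHomogeneousVec a' b (f v)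

/-- A minimal multigraded free resolution of `R/M`:
`⋯ → F_2 → F_1 → F_0 → R/M → 0` with `F_i = ⊕_j R(-deg i j)` of finite rank. -/
structure MinimalResolution {k : Type*} [Field k] {d : ℕ}
    (M : Ideal (MvPolynomial (Fin d) k)) where
  /-- the rank of `F_i` -/
  rank : ℕ → ℕ
  /-- the multidegrees of the basis vectors of `F_i` -/
  deg : ∀ i, Fin (rank i) → (Fin d →₀ ℕ)
  /-- the differential `F_{i+1} → F_i` -/
  diff : ∀ i, (Fin (rank (i + 1)) → MvPolynomial (Fin d) k) →ₗ[MvPolynomial (Fin d) k]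
    (Fin (rank i) → MvPolynomial (Fin d) k)
  /-- the augmentation `F_0 → R/M` -/
  aug : (Fin (rank 0) → MvPolynomial (Fin d) k) →ₗ[MvPolynomial (Fin d) k]
    (MvPolynomial (Fin d) k ⧸ M)
  diff_degreeZero : ∀ i, IsDegreeZero (deg (i + 1)) (deg i) (diff i)
  /-- The part of `R/M` of multidegree `b` consists of the classes of the `c x^b`, `c ∈ k`. -/
  aug_degreeZero : ∀ b v, IsHomogeneousVec (deg 0) b v →
    ∃ c : k, aug v = Ideal.Quotient.mk M (monomial b c)
  aug_surjective : Function.Surjective aug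
  exact_zero : Function.Exact (diff 0) aug
  exact_succ : ∀ i, Function.Exact (diff (i + 1)) (diff i)
  /-- Minimality: the image of the differential lies in `(x_1, …, x_d) F_i`. -/
  minimal : ∀ i, LinearMap.range (diff i) ≤
    Ideal.span (Set.range (X : Fin d → MvPolynomial (Fin d) k)) • ⊤

namespace MinimalResolution

variable {k : Type*} [Field k] {d : ℕ} {M : Ideal (MvPolynomial (Fin d) k)}

/-- The number of summands `R(-b)` of `F_i`. -/
def rankInDegree (F : MinimalResolution M) (i : ℕ) (b : Fin d →₀ ℕ) : ℕ :=
  (Finset.univ.filter (fun j => F.deg i j = b)).card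

/-- A choice of a multigraded basis of every `F_i`: homogeneous bases, ordered so that the
`j`-th vector of the basis of `F_i` has multidegree `deg i j`. -/
structure BasisChoice (F : MinimalResolution M) where
  basis : ∀ i, Module.Basis (Fin (F.rank i)) (MvPolynomial (Fin d) k)
    (Fin (F.rank i) → MvPolynomial (Fin d) k)
  homogeneous : ∀ i j, IsHomogeneousVec (F.deg i) (F.deg i j) (basis i j)

/-- The representative of the differential `F_{i+1} → F_i` for a choice of multigraded bases:
its matrix in these bases, read as a map between the standard free modules. -/
noncomputable def diffRep (F : MinimalResolution M) (B : F.BasisChoice) (i : ℕ) :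
    (Fin (F.rank (i + 1)) → MvPolynomial (Fin d) k) →ₗ[MvPolynomial (Fin d) k]
      (Fin (F.rank i) → MvPolynomial (Fin d) k) :=
  Matrix.toLin' (LinearMap.toMatrix (B.basis (i + 1)) (B.basis i) (F.diff i))

/-- An automorphism of the resolution: a family of multigraded (degree `0`) isomorphisms
`f_i : F_i → F_i` with `d'_i ∘ f_i = f_{i-1} ∘ d_i` for every `i ≥ 1`, where `d` and `d'` are
representatives of the differential that come from choices of multigraded bases. The two
choices may differ: the notion is wider than that of an automorphism of the complex with a
fixed differential. -/
structure Automorphism (F : MinimalResolution M) where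
  toEquiv : ∀ i, (Fin (F.rank i) → MvPolynomial (Fin d) k) ≃ₗ[MvPolynomial (Fin d) k]
    (Fin (F.rank i) → MvPolynomial (Fin d) k)
  degreeZero : ∀ i, IsDegreeZero (F.deg i) (F.deg i) (toEquiv i).toLinearMap
  comm : ∃ B B' : F.BasisChoice, ∀ i,
    F.diffRep B' i ∘ₗ (toEquiv (i + 1)).toLinearMap = (toEquiv i).toLinearMap ∘ₗ F.diffRep B i

/-- An automorphism is trivial if each `f_i` is represented by a diagonal matrix with units of
`k` along the diagonal. -/
def Automorphism.IsTrivial {F : MinimalResolution M} (f : F.Automorphism) : Prop :=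
  ∀ i, ∃ u : Fin (F.rank i) → kˣ,
    LinearMap.toMatrix' (f.toEquiv i).toLinearMap = Matrix.diagonal (fun j => C (u j : k))

end MinimalResolution

open Classical in
/-- The multigraded Betti number `β_{i,b}(R/M)`: the number of summands `R(-b)` in homological
degree `i` of a minimal multigraded free resolution of `R/M`. For monomial ideals such a
resolution exists and is unique up to isomorphism, so the choice made here does not matter. -/
noncomputable def multigradedBetti {k : Type*} [Field k] {d : ℕ}
    (M : Ideal (MvPolynomial (Fin d) k)) (i : ℕ) (b : Fin d →₀ ℕ) : ℕ :=
  if h : Nonempty (MinimalResolution M) then h.some.rankInDegree i b else 0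

/-- A rigid monomial ideal: (R1) every multigraded Betti number of `R/M` is `0` or `1`, and
(R2) distinct multidegrees with Betti number `1` in the same homological degree are
incomparable in the lcm-lattice. -/
structure IsRigid {k : Type*} [Field k] {d : ℕ} (M : Ideal (MvPolynomial (Fin d) k)) : Prop where
  isMonomial : IsMonomialIdeal M
  betti_le_one : ∀ i b, multigradedBetti M i b = 0 ∨ multigradedBetti M i b = 1
  incomparable : ∀ (i : ℕ) (b b' : lcmLattice M), b ≠ b' →
    multigradedBetti M i b = 1 → multigradedBetti M i b' = 1 → ¬ b ≤ b' ∧ ¬ b' ≤ b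

/-! An automorphism may relate two different choices of bases, so any family of degree zero
isomorphisms is one: transport the basis along it (`Automorphism.ofEquiv`). Compatibility with the
differential thus imposes nothing, and the question becomes which `F_i` have only diagonal degree
zero automorphisms. If `deg i j' ≤ deg i j` with `j ≠ j'`, a transvection is a nontrivial one
(`eq_of_deg_le`). If no such pair exists, degree reasons force every matrix to be diagonal
(`Automorphism.isTrivial_of_deg`). So triviality means that the basis degrees of each `F_i` are
pairwise distinct and incomparable. To read this as rigidity, two facts are needed: Betti numbers
can be computed from the given `F` (`multigradedBetti_eq_rankInDegree`, by comparing resolutions up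
to homotopy), and all basis degrees lie in the lcm-lattice (`deg_mem_lcmLattice`), where (R2) is
stated. -/

section HomogeneousVectors

variable {k : Type*} [Field k] {d r s : ℕ}

/-! ### Multigraded free modules and degree zero maps -/

lemma isHomogeneousVec_single (a : Fin r → (Fin d →₀ ℕ)) (j : Fin r) (m : Fin d →₀ ℕ) (c : k) :
    IsHomogeneousVec a (a j + m) (Pi.single j (monomial m c)) := by
  intro j' m' hm'
  rcases eq_or_ne j' j with rfl | h
  · rw [Pi.single_eq_same] at hm'
    rw [Finset.mem_singleton.1 (support_monomial_subset hm')]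
  · simp [Pi.single_eq_of_ne h] at hm'

lemma isHomogeneousVec_single_one (a : Fin r → (Fin d →₀ ℕ)) (j : Fin r) :
    IsHomogeneousVec a (a j) (Pi.single j (1 : MvPolynomial (Fin d) k)) := by
  simpa using isHomogeneousVec_single a j 0 (1 : k)

lemma IsHomogeneousVec.add {a : Fin r → (Fin d →₀ ℕ)} {b : Fin d →₀ ℕ}
    {v w : Fin r → MvPolynomial (Fin d) k} (hv : IsHomogeneousVec a b v)
    (hw : IsHomogeneousVec a b w) : IsHomogeneousVec a b (v + w) := by
  intro j m hm
  rcases Finset.mem_union.1 (support_add hm) with h | h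
  · exact hv j m h
  · exact hw j m h

lemma IsHomogeneousVec.neg {a : Fin r → (Fin d →₀ ℕ)} {b : Fin d →₀ ℕ}
    {v : Fin r → MvPolynomial (Fin d) k} (hv : IsHomogeneousVec a b v) :
    IsHomogeneousVec a b (-v) := by
  intro j m hm
  exact hv j m (by simpa using hm)

lemma IsHomogeneousVec.sum {ι : Type*} {a : Fin r → (Fin d →₀ ℕ)} {b : Fin d →₀ ℕ}
    {v : ι → Fin r → MvPolynomial (Fin d) k} {t : Finset ι}
    (hv : ∀ i ∈ t, IsHomogeneousVec a b (v i)) : IsHomogeneousVec a b (∑ i ∈ t, v i) := by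
  classical
  induction t using Finset.induction_on with
  | empty => intro j m hm; simp at hm
  | insert i t hi ih =>
    rw [Finset.sum_insert hi]
    exact (hv i (by simp)).add (ih fun i' hi' => hv i' (by simp [hi']))

/-- The linear map sending the standard basis to homogeneous vectors of the right degrees
has degree zero. -/
lemma isDegreeZero_of_single {a : Fin r → (Fin d →₀ ℕ)} {a' : Fin s → (Fin d →₀ ℕ)}
    (f : (Fin r → MvPolynomial (Fin d) k) →ₗ[MvPolynomial (Fin d) k]
      (Fin s → MvPolynomial (Fin d) k))
    (hf : ∀ j, IsHomogeneousVec a' (a j) (f (Pi.single j 1))) : IsDegreeZero a a' f := by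
  intro b v hv
  rw [LinearMap.pi_apply_eq_sum_univ f v]
  refine IsHomogeneousVec.sum fun j _ => ?_
  intro j' m hm
  rw [Pi.smul_apply, smul_eq_mul] at hm
  obtain ⟨m₁, h₁, m₂, h₂, rfl⟩ := Finset.mem_add.1 (support_mul _ _ hm)
  have h₂' := hf j j' m₂ (by convert h₂ using 4; simp [Pi.single_apply, eq_comm])
  rw [← hv j m₁ h₁, ← h₂', add_comm m₁, add_assoc]

open Classical in
/-- The component of multidegree `b` of a vector. -/
noncomputable def homogeneousPart (a : Fin r → (Fin d →₀ ℕ)) (b : Fin d →₀ ℕ)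
    (v : Fin r → MvPolynomial (Fin d) k) : Fin r → MvPolynomial (Fin d) k :=
  fun j => if a j ≤ b then monomial (b - a j) (coeff (b - a j) (v j)) else 0

lemma homogeneousPart_add (a : Fin r → (Fin d →₀ ℕ)) (b : Fin d →₀ ℕ)
    (v w : Fin r → MvPolynomial (Fin d) k) :
    homogeneousPart a b (v + w) = homogeneousPart a b v + homogeneousPart a b w := by
  ext1 j
  by_cases h : a j ≤ b <;> simp [homogeneousPart, h]

lemma isHomogeneousVec_homogeneousPart (a : Fin r → (Fin d →₀ ℕ)) (b : Fin d →₀ ℕ)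
    (v : Fin r → MvPolynomial (Fin d) k) : IsHomogeneousVec a b (homogeneousPart a b v) := by
  intro j m hm
  by_cases h : a j ≤ b
  · simp only [homogeneousPart, h, if_true] at hm
    rw [Finset.mem_singleton.1 (support_monomial_subset hm), add_tsub_cancel_of_le h]
  · simp [homogeneousPart, h] at hm

lemma IsHomogeneousVec.homogeneousPart_eq {a : Fin r → (Fin d →₀ ℕ)} {b : Fin d →₀ ℕ}
    {v : Fin r → MvPolynomial (Fin d) k} (hv : IsHomogeneousVec a b v) :
    homogeneousPart a b v = v := by
  classical
  ext j m
  by_cases hm : m ∈ (v j).support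
  · have h := hv j m hm
    subst h
    simp [homogeneousPart]
  · have h0 : coeff m (v j) = 0 := by simpa using hm
    rw [h0]
    by_cases h : a j ≤ b
    · simp only [homogeneousPart, h, if_true, coeff_monomial]
      split_ifs with h'
      · rw [h', h0]
      · rfl
    · simp [homogeneousPart, h]

lemma IsHomogeneousVec.homogeneousPart_eq_zero {a : Fin r → (Fin d →₀ ℕ)} {b b' : Fin d →₀ ℕ}
    {v : Fin r → MvPolynomial (Fin d) k} (hv : IsHomogeneousVec a b v) (h : b' ≠ b) :
    homogeneousPart a b' v = 0 := by
  ext1 j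
  by_cases hj : a j ≤ b'
  · simp only [homogeneousPart, hj, if_true, Pi.zero_apply, monomial_eq_zero]
    by_contra hc
    have := hv j _ (mem_support_iff.2 hc)
    rw [add_tsub_cancel_of_le hj] at this
    exact h this
  · simp [homogeneousPart, hj]

lemma vec_induction {P : (Fin r → MvPolynomial (Fin d) k) → Prop}
    (add : ∀ v w, P v → P w → P (v + w)) (zero : P 0)
    (single : ∀ j m c, P (Pi.single j (monomial m c))) (v : Fin r → MvPolynomial (Fin d) k) :
    P v := by
  rw [← Finset.univ_sum_single v]
  refine Finset.sum_induction _ P add zero fun j _ => ?_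
  induction v j using MvPolynomial.induction_on' with
  | monomial m c => exact single j m c
  | add p q hp hq => rw [Pi.single_add]; exact add _ _ hp hq

lemma IsDegreeZero.map_homogeneousPart {a : Fin r → (Fin d →₀ ℕ)} {a' : Fin s → (Fin d →₀ ℕ)}
    {f : (Fin r → MvPolynomial (Fin d) k) →ₗ[MvPolynomial (Fin d) k]
      (Fin s → MvPolynomial (Fin d) k)} (hf : IsDegreeZero a a' f) (b : Fin d →₀ ℕ)
    (v : Fin r → MvPolynomial (Fin d) k) :
    f (homogeneousPart a b v) = homogeneousPart a' b (f v) := by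
  induction v using vec_induction with
  | add v w hv hw => rw [homogeneousPart_add, map_add, map_add, homogeneousPart_add, hv, hw]
  | zero =>
    have h0 : ∀ {r : ℕ} (a : Fin r → (Fin d →₀ ℕ)),
        homogeneousPart a b (0 : Fin r → MvPolynomial (Fin d) k) = 0 := fun a => by
      ext1 j; simp [homogeneousPart]
    rw [h0, map_zero, h0]
  | single j m c =>
    have h := isHomogeneousVec_single a j m c
    rcases eq_or_ne b (a j + m) with rfl | hb
    · rw [h.homogeneousPart_eq, (hf _ _ h).homogeneousPart_eq]
    · rw [h.homogeneousPart_eq_zero hb, (hf _ _ h).homogeneousPart_eq_zero hb, map_zero]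

lemma IsDegreeZero.exists_homogeneous_preimage {a : Fin r → (Fin d →₀ ℕ)}
    {a' : Fin s → (Fin d →₀ ℕ)}
    {f : (Fin r → MvPolynomial (Fin d) k) →ₗ[MvPolynomial (Fin d) k]
      (Fin s → MvPolynomial (Fin d) k)} (hf : IsDegreeZero a a' f) {b : Fin d →₀ ℕ}
    {w : Fin s → MvPolynomial (Fin d) k} (hw : IsHomogeneousVec a' b w)
    (h : w ∈ LinearMap.range f) : ∃ v, IsHomogeneousVec a b v ∧ f v = w := by
  obtain ⟨v, rfl⟩ := h
  exact ⟨homogeneousPart a b v, isHomogeneousVec_homogeneousPart a b v, by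
    rw [hf.map_homogeneousPart, hw.homogeneousPart_eq]⟩

/-- A homogeneous vector supported on basis vectors of degree at most `c` is divisible by
`x^(b - c)`. -/
lemma IsHomogeneousVec.exists_eq_monomial_smul {a : Fin r → (Fin d →₀ ℕ)} {b c : Fin d →₀ ℕ}
    {v : Fin r → MvPolynomial (Fin d) k} (hv : IsHomogeneousVec a b v) (hcb : c ≤ b)
    (h : ∀ j, a j ≤ b → a j ≤ c) :
    ∃ w, IsHomogeneousVec a c w ∧ v = monomial (b - c) (1 : k) • w := by
  classical
  refine ⟨fun j => if a j ≤ b then monomial (c - a j) (coeff (b - a j) (v j)) else 0, ?_, ?_⟩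
  · intro j m hm
    by_cases hj : a j ≤ b
    · simp only [hj, if_true] at hm
      rw [Finset.mem_singleton.1 (support_monomial_subset hm), add_tsub_cancel_of_le (h j hj)]
    · simp [hj] at hm
  · conv_lhs => rw [← hv.homogeneousPart_eq]
    ext1 j
    by_cases hj : a j ≤ b
    · simp only [homogeneousPart, hj, if_true, Pi.smul_apply, smul_eq_mul, monomial_mul, one_mul,
        tsub_add_tsub_cancel hcb (h j hj)]
    · simp [homogeneousPart, hj]

lemma constantCoeff_eq_zero_of_mem_smul_top {v : Fin r → MvPolynomial (Fin d) k}
    (hv : v ∈ Ideal.span (Set.range (X : Fin d → MvPolynomial (Fin d) k)) •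
      (⊤ : Submodule (MvPolynomial (Fin d) k) (Fin r → MvPolynomial (Fin d) k))) (j : Fin r) :
    constantCoeff (v j) = 0 := by
  have hle : Ideal.span (Set.range (X : Fin d → MvPolynomial (Fin d) k)) ≤
      RingHom.ker (constantCoeff : MvPolynomial (Fin d) k →+* k) := by
    rw [Ideal.span_le]
    rintro _ ⟨i, rfl⟩
    simp [RingHom.mem_ker]
  refine Submodule.smul_induction_on hv (fun p hp w _ => ?_) fun v w hv hw => ?_
  · have := hle hp
    rw [RingHom.mem_ker] at this
    simp [this]
  · simp [hv, hw]

/-- Freeness of the source: choose preimages on the basis. The predicate `P` records the degree of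
the chosen preimages. -/
lemma exists_linearMap_lift {R N : Type*} [CommRing R] [AddCommGroup N] [Module R N]
    {P : (Fin s → R) → Fin r → Prop} (f : (Fin s → R) →ₗ[R] N) (g : (Fin r → R) →ₗ[R] N)
    (h : ∀ j, ∃ v, P v j ∧ f v = g (Pi.single j 1)) :
    ∃ φ : (Fin r → R) →ₗ[R] (Fin s → R),
      (∀ v, f (φ v) = g v) ∧ ∀ j, P (φ (Pi.single j 1)) j := by
  choose v hP hv using h
  have hφ : ∀ j, (Pi.basisFun R (Fin r)).constr R v (Pi.single j 1) = v j := fun j => by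
    rw [← Pi.basisFun_apply, Module.Basis.constr_basis]
  refine ⟨(Pi.basisFun R (Fin r)).constr R v, fun w => ?_, fun j => by rw [hφ]; exact hP j⟩
  have : f ∘ₗ (Pi.basisFun R (Fin r)).constr R v = g := by
    refine (Pi.basisFun R (Fin r)).ext fun j => ?_
    rw [LinearMap.comp_apply, Module.Basis.constr_basis, Pi.basisFun_apply, hv]
  exact LinearMap.congr_fun this w

/-- A degree zero map has constants only between basis vectors of equal degree. -/
lemma IsDegreeZero.deg_eq_of_constantCoeff_ne_zero {a : Fin r → (Fin d →₀ ℕ)}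
    {a' : Fin s → (Fin d →₀ ℕ)}
    {f : (Fin r → MvPolynomial (Fin d) k) →ₗ[MvPolynomial (Fin d) k]
      (Fin s → MvPolynomial (Fin d) k)} (hf : IsDegreeZero a a' f) {j : Fin r} {j' : Fin s}
    (h : constantCoeff (f (Pi.single j 1) j') ≠ 0) : a' j' = a j := by
  simpa using hf _ _ (isHomogeneousVec_single_one a j) j' 0 (by
    rw [mem_support_iff]; exact h)

/-- Modulo the variables, `f` only links basis vectors of equal degree. The degree `b` blocks `A` of
`f` and `B` of `g` therefore satisfy `B * A = 1` over `k`, and rank bounds the sizes. -/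
lemma card_filter_le_of_comp_eq_id_mod {a : Fin r → (Fin d →₀ ℕ)} {a' : Fin s → (Fin d →₀ ℕ)}
    {f : (Fin r → MvPolynomial (Fin d) k) →ₗ[MvPolynomial (Fin d) k]
      (Fin s → MvPolynomial (Fin d) k)}
    {g : (Fin s → MvPolynomial (Fin d) k) →ₗ[MvPolynomial (Fin d) k]
      (Fin r → MvPolynomial (Fin d) k)} (hf : IsDegreeZero a a' f)
    (h : ∀ v j, constantCoeff (g (f v) j) = constantCoeff (v j)) (b : Fin d →₀ ℕ) :
    (Finset.univ.filter (fun j => a j = b)).card ≤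
      (Finset.univ.filter (fun j => a' j = b)).card := by
  classical
  let A : Matrix {j // a' j = b} {j // a j = b} k :=
    fun j' j => constantCoeff (f (Pi.single j.1 1) j'.1)
  let B : Matrix {j // a j = b} {j // a' j = b} k :=
    fun j j' => constantCoeff (g (Pi.single j'.1 1) j.1)
  have hBA : B * A = 1 := by
    ext j₂ j
    have h1 := h (Pi.single j.1 1) j₂.1
    have h2 : g (f (Pi.single j.1 1)) =
        ∑ j', f (Pi.single j.1 1) j' • g (Pi.single j' 1) := by
      conv_lhs => rw [← Finset.univ_sum_single (f (Pi.single j.1 1))]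
      rw [map_sum]
      refine Finset.sum_congr rfl fun j' _ => ?_
      rw [← map_smul, ← Pi.single_smul, smul_eq_mul, mul_one]
    rw [h2, Finset.sum_apply, map_sum] at h1
    rw [Matrix.mul_apply, Matrix.one_apply]
    have h3 : constantCoeff ((Pi.single j.1 (1 : MvPolynomial (Fin d) k) :
        Fin r → MvPolynomial (Fin d) k) j₂.1) = if j₂ = j then (1 : k) else 0 := by
      by_cases e : j₂ = j
      · simp [e]
      · rw [Pi.single_eq_of_ne (fun e' => e (Subtype.ext e'))]; simp [e]
    rw [← h3, ← h1]
    have h4 : ∀ j' : Fin s, j' ∉ Finset.univ.filter (fun j' => a' j' = b) →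
        constantCoeff ((f (Pi.single j.1 1) j' • g (Pi.single j' 1)) j₂.1) = 0 := by
      intro j' hj'
      have : constantCoeff (f (Pi.single j.1 1) j') = 0 := by
        by_contra hc
        exact hj' (by simp [hf.deg_eq_of_constantCoeff_ne_zero hc, j.2])
      simp [this]
    rw [← Finset.sum_subset (Finset.subset_univ _) fun j' _ hj' => h4 j' hj']
    rw [← Finset.sum_subtype_eq_sum_filter, Finset.subtype_univ]
    refine Finset.sum_congr rfl fun j' _ => ?_
    simp [A, B, mul_comm]
  have h5 := Matrix.rank_mul_le_left B A
  rw [hBA, Matrix.rank_one] at h5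
  have h6 := h5.trans (Matrix.rank_le_card_width B)
  simpa [Fintype.card_subtype] using h6

end HomogeneousVectors

namespace MinimalResolution

variable {k : Type*} [Field k] {d : ℕ} {M : Ideal (MvPolynomial (Fin d) k)}

/-! ### Independence of Betti numbers from the resolution -/

lemma _root_.IsMonomialIdeal.monomial_coeff_mem (hM : IsMonomialIdeal M)
    {p : MvPolynomial (Fin d) k} (hp : p ∈ M) (b : Fin d →₀ ℕ) : monomial b (coeff b p) ∈ M := by
  classical
  obtain ⟨S, rfl⟩ := hM
  rw [mem_ideal_span_monomial_image] at hp ⊢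
  intro m hm
  have hmb := Finset.mem_singleton.1 (support_monomial_subset hm)
  subst hmb
  refine hp m ?_
  simpa using hm

lemma monomial_one_mem {b : Fin d →₀ ℕ} {c : k} (hc : c ≠ 0) (h : monomial b c ∈ M) :
    monomial b (1 : k) ∈ M := by
  have := M.mul_mem_left (C c⁻¹) h
  rwa [C_mul_monomial, inv_mul_cancel₀ hc] at this

/-- The grading of `R/M` is only visible through representatives; components are well defined
because `M` is monomial. -/
lemma aug_homogeneousPart (hM : IsMonomialIdeal M) (F : MinimalResolution M)
    {v : Fin (F.rank 0) → MvPolynomial (Fin d) k} {p : MvPolynomial (Fin d) k}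
    (hv : F.aug v = Ideal.Quotient.mk M p) (b : Fin d →₀ ℕ) :
    F.aug (homogeneousPart (F.deg 0) b v) = Ideal.Quotient.mk M (monomial b (coeff b p)) := by
  classical
  -- The induction builds its own representative `q`, since `p` does not decompose along `v`; the
  -- two agree modulo `M`.
  have key : ∃ q, F.aug v = Ideal.Quotient.mk M q ∧ F.aug (homogeneousPart (F.deg 0) b v) =
      Ideal.Quotient.mk M (monomial b (coeff b q)) := by
    clear hv
    induction v using vec_induction with
    | add v w hv hw =>
      obtain ⟨p, hp, hp'⟩ := hv
      obtain ⟨q, hq, hq'⟩ := hw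
      exact ⟨p + q, by rw [map_add, map_add, hp, hq], by
        rw [homogeneousPart_add, map_add, hp', hq', coeff_add, ← map_add, ← map_add]⟩
    | zero =>
      have : homogeneousPart (k := k) (F.deg 0) b 0 = 0 := by ext1 j; simp [homogeneousPart]
      exact ⟨0, by simp, by simp [this]⟩
    | single j m c =>
      have h := isHomogeneousVec_single (F.deg 0) j m c
      obtain ⟨c', hc'⟩ := F.aug_degreeZero _ _ h
      refine ⟨_, hc', ?_⟩
      rcases eq_or_ne b (F.deg 0 j + m) with rfl | hb
      · rw [h.homogeneousPart_eq, hc', coeff_monomial, if_pos rfl]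
      · rw [h.homogeneousPart_eq_zero hb, coeff_monomial, if_neg hb.symm]
        simp
  obtain ⟨q, hq, hq'⟩ := key
  rw [hq', Ideal.Quotient.eq, ← map_sub, ← coeff_sub]
  exact hM.monomial_coeff_mem (Ideal.Quotient.eq.1 (hq.symm.trans hv)) b

lemma smul_quotient_mk (p q : MvPolynomial (Fin d) k) :
    p • Ideal.Quotient.mk M q = Ideal.Quotient.mk M (p * q) :=
  rfl

lemma exists_homogeneous_aug_eq (hM : IsMonomialIdeal M) (F : MinimalResolution M)
    (b : Fin d →₀ ℕ) (c : k) : ∃ v, IsHomogeneousVec (F.deg 0) b v ∧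
      F.aug v = Ideal.Quotient.mk M (monomial b c) := by
  obtain ⟨v, hv⟩ := F.aug_surjective (Ideal.Quotient.mk M (monomial b c))
  exact ⟨_, isHomogeneousVec_homogeneousPart _ b v, by
    rw [aug_homogeneousPart hM F hv b, coeff_monomial, if_pos rfl]⟩

lemma constantCoeff_diff (F : MinimalResolution M) (i : ℕ)
    (v : Fin (F.rank (i + 1)) → MvPolynomial (Fin d) k) (j : Fin (F.rank i)) :
    constantCoeff (F.diff i v j) = 0 :=
  constantCoeff_eq_zero_of_mem_smul_top (F.minimal i ⟨v, rfl⟩) j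

lemma exists_comparison (hM : IsMonomialIdeal M) (F G : MinimalResolution M) :
    ∃ φ : (Fin (F.rank 0) → MvPolynomial (Fin d) k) →ₗ[MvPolynomial (Fin d) k]
        (Fin (G.rank 0) → MvPolynomial (Fin d) k),
      IsDegreeZero (F.deg 0) (G.deg 0) φ ∧ ∀ v, G.aug (φ v) = F.aug v := by
  obtain ⟨φ, h1, h2⟩ := exists_linearMap_lift
    (P := fun v j => IsHomogeneousVec (G.deg 0) (F.deg 0 j) v) G.aug F.aug (fun j => by
      obtain ⟨c, hc⟩ := F.aug_degreeZero _ _ (isHomogeneousVec_single_one (F.deg 0) j)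
      rw [hc]
      exact exists_homogeneous_aug_eq hM G _ c)
  exact ⟨φ, isDegreeZero_of_single φ h2, h1⟩

lemma exists_comparison_succ (F G : MinimalResolution M) (i : ℕ)
    {φ : (Fin (F.rank i) → MvPolynomial (Fin d) k) →ₗ[MvPolynomial (Fin d) k]
      (Fin (G.rank i) → MvPolynomial (Fin d) k)}
    (hφ : IsDegreeZero (F.deg i) (G.deg i) φ)
    (h : ∀ v, φ (F.diff i v) ∈ LinearMap.range (G.diff i)) :
    ∃ φ' : (Fin (F.rank (i + 1)) → MvPolynomial (Fin d) k) →ₗ[MvPolynomial (Fin d) k]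
        (Fin (G.rank (i + 1)) → MvPolynomial (Fin d) k),
      IsDegreeZero (F.deg (i + 1)) (G.deg (i + 1)) φ' ∧
      ∀ v, G.diff i (φ' v) = φ (F.diff i v) := by
  obtain ⟨φ', h1, h2⟩ := exists_linearMap_lift
    (P := fun v j => IsHomogeneousVec (G.deg (i + 1)) (F.deg (i + 1) j) v)
    (G.diff i) (φ ∘ₗ F.diff i) (fun j => (G.diff_degreeZero i).exists_homogeneous_preimage
      (hφ _ _ (F.diff_degreeZero i _ _ (isHomogeneousVec_single_one _ j))) (h _))
  exact ⟨φ', isDegreeZero_of_single φ' h2, h1⟩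

/-- Two minimal resolutions are compared by degree zero maps `φ`, `ψ`, and `ψ ∘ φ` is homotopic
to the identity: `ψ ∘ φ - id - d ∘ h` is the other term of the homotopy, which vanishes on
boundaries and is zero modulo the variables. -/
lemma exists_homotopy (hM : IsMonomialIdeal M) (F G : MinimalResolution M) (i : ℕ) :
    ∃ (φ : (Fin (F.rank i) → MvPolynomial (Fin d) k) →ₗ[MvPolynomial (Fin d) k]
        (Fin (G.rank i) → MvPolynomial (Fin d) k))
      (ψ : (Fin (G.rank i) → MvPolynomial (Fin d) k) →ₗ[MvPolynomial (Fin d) k]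
        (Fin (F.rank i) → MvPolynomial (Fin d) k))
      (h : (Fin (F.rank i) → MvPolynomial (Fin d) k) →ₗ[MvPolynomial (Fin d) k]
        (Fin (F.rank (i + 1)) → MvPolynomial (Fin d) k)),
      IsDegreeZero (F.deg i) (G.deg i) φ ∧ IsDegreeZero (G.deg i) (F.deg i) ψ ∧
      (∀ v, φ (F.diff i v) ∈ LinearMap.range (G.diff i)) ∧
      (∀ v, ψ (G.diff i v) ∈ LinearMap.range (F.diff i)) ∧
      (∀ v, ψ (φ (F.diff i v)) - F.diff i v = F.diff i (h (F.diff i v))) ∧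
      (∀ v, ψ (φ v) - v - F.diff i (h v) ∈
        Ideal.span (Set.range (X : Fin d → MvPolynomial (Fin d) k)) •
        (⊤ : Submodule (MvPolynomial (Fin d) k) (Fin (F.rank i) → MvPolynomial (Fin d) k))) := by
  induction i with
  | zero =>
    obtain ⟨φ, hφ, hφa⟩ := exists_comparison hM F G
    obtain ⟨ψ, hψ, hψa⟩ := exists_comparison hM G F
    obtain ⟨h, hh, -⟩ := exists_linearMap_lift (P := fun _ _ => True) (F.diff 0)
      (ψ ∘ₗ φ - LinearMap.id) (fun j => by
        obtain ⟨v, hv⟩ := (F.exact_zero (ψ (φ (Pi.single j 1)) - Pi.single j 1)).1 (by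
          rw [map_sub, hψa, hφa, sub_self])
        exact ⟨v, trivial, hv⟩)
    refine ⟨φ, ψ, h, hφ, hψ, fun v => ?_, fun v => ?_, fun v => ?_, fun v => ?_⟩
    · exact (G.exact_zero _).1 (by rw [hφa]; exact F.exact_zero.apply_apply_eq_zero v)
    · exact (F.exact_zero _).1 (by rw [hψa]; exact G.exact_zero.apply_apply_eq_zero v)
    · rw [hh]; rfl
    · rw [hh]; simp
  | succ i ih =>
    obtain ⟨φ, ψ, h, hφ, hψ, hφr, hψr, hh, -⟩ := ih
    obtain ⟨φ', hφ', hφc⟩ := exists_comparison_succ F G i hφ hφr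
    obtain ⟨ψ', hψ', hψc⟩ := exists_comparison_succ G F i hψ hψr
    -- The usual homotopy recursion: `ψ' ∘ φ' - id - h ∘ d` takes values in cycles, so it lifts
    -- through the next differential.
    obtain ⟨h', hh', -⟩ := exists_linearMap_lift (P := fun _ _ => True) (F.diff (i + 1))
      (ψ' ∘ₗ φ' - LinearMap.id - h ∘ₗ F.diff i) (fun j => by
        obtain ⟨v, hv⟩ := (F.exact_succ i (ψ' (φ' (Pi.single j 1)) - Pi.single j 1 -
          h (F.diff i (Pi.single j 1)))).1 (by
            rw [map_sub, map_sub, hψc, hφc, hh, sub_self])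
        exact ⟨v, trivial, hv⟩)
    refine ⟨φ', ψ', h', hφ', hψ', fun v => ?_, fun v => ?_, fun v => ?_, fun v => ?_⟩
    · exact (G.exact_succ i _).1 (by rw [hφc, (F.exact_succ i).apply_apply_eq_zero, map_zero])
    · exact (F.exact_succ i _).1 (by rw [hψc, (G.exact_succ i).apply_apply_eq_zero, map_zero])
    · rw [hh']
      simp [(F.exact_succ i).apply_apply_eq_zero]
    · rw [hh']
      simp only [LinearMap.sub_apply, LinearMap.comp_apply, LinearMap.id_apply, sub_sub_cancel]
      -- The remaining term is `h (d v)`, small because `d` is minimal and `h` is linear.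
      have h1 := Submodule.mem_map_of_mem (f := h) (F.minimal i ⟨v, rfl⟩)
      rw [Submodule.map_smul''] at h1
      exact Submodule.smul_mono le_rfl le_top h1

lemma rankInDegree_le (hM : IsMonomialIdeal M) (F G : MinimalResolution M) (i : ℕ)
    (b : Fin d →₀ ℕ) : F.rankInDegree i b ≤ G.rankInDegree i b := by
  obtain ⟨φ, ψ, h, hφ, -, -, -, -, hh⟩ := exists_homotopy hM F G i
  refine card_filter_le_of_comp_eq_id_mod (f := φ) (g := ψ) hφ (fun v j => ?_) b
  have h1 := constantCoeff_eq_zero_of_mem_smul_top (hh v) j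
  simpa [constantCoeff_diff, sub_eq_zero] using h1

lemma multigradedBetti_eq_rankInDegree (hM : IsMonomialIdeal M) (F : MinimalResolution M) (i : ℕ)
    (b : Fin d →₀ ℕ) : multigradedBetti M i b = F.rankInDegree i b := by
  have h : Nonempty (MinimalResolution M) := ⟨F⟩
  rw [multigradedBetti, dif_pos h]
  exact le_antisymm (rankInDegree_le hM _ _ i b) (rankInDegree_le hM _ _ i b)

/-! ### Basis degrees and the lcm-lattice -/

/-- The largest element of the lcm-lattice dividing `b`. -/
lemma exists_lcm_le (M : Ideal (MvPolynomial (Fin d) k)) (b : Fin d →₀ ℕ) :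
    ∃ c ∈ lcmLattice M, c ≤ b ∧ (∀ a ∈ lcmLattice M, a ≤ b → a ≤ c) ∧
      (monomial b (1 : k) ∈ M → monomial c (1 : k) ∈ M) := by
  classical
  -- All minimal generators dividing `x^b`.
  let S : Finset (Fin d →₀ ℕ) := (Finset.Iic b).filter (· ∈ minimalGenerators M)
  refine ⟨S.sup id, ⟨S, fun a ha => (Finset.mem_filter.1 ha).2, rfl⟩,
    Finset.sup_le fun a ha => Finset.mem_Iic.1 (Finset.mem_filter.1 ha).1, ?_, fun hb => ?_⟩
  · rintro _ ⟨T, hT, rfl⟩ hTb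
    refine Finset.sup_mono fun a ha => Finset.mem_filter.2 ⟨Finset.mem_Iic.2 ?_, hT ha⟩
    exact (Finset.le_sup (f := id) ha).trans hTb
  · obtain ⟨a, hab, ha⟩ := exists_minimal_le_of_wellFoundedLT
      (fun a' => monomial a' (1 : k) ∈ M) b hb
    have hac : a ≤ S.sup id := Finset.le_sup (f := id)
      (Finset.mem_filter.2 ⟨Finset.mem_Iic.2 hab, ha⟩)
    have := M.mul_mem_left (monomial (S.sup id - a) (1 : k)) ha.prop
    rwa [monomial_mul, one_mul, tsub_add_cancel_of_le hac] at this

lemma constantCoeff_monomial_smul {r : ℕ} {m : Fin d →₀ ℕ} (hm : m ≠ 0) (c : k)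
    (w : Fin r → MvPolynomial (Fin d) k) (j : Fin r) :
    constantCoeff ((monomial m c • w) j) = 0 := by
  classical
  rw [Pi.smul_apply, smul_eq_mul, map_mul, constantCoeff_monomial, if_neg hm, zero_mul]

/-- Otherwise, with `w` a lift of `1`, the vector `e_j - c x^(deg j) w` is a boundary whose `j`-th
entry has constant term `1`, against minimality. -/
lemma deg_zero_eq (hM : IsMonomialIdeal M) (F : MinimalResolution M) (j : Fin (F.rank 0)) :
    F.deg 0 j = 0 := by
  by_contra hb
  obtain ⟨c, hc⟩ := F.aug_degreeZero _ _ (isHomogeneousVec_single_one (F.deg 0) j)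
  obtain ⟨w, -, hw⟩ := exists_homogeneous_aug_eq hM F 0 1
  have h0 : F.aug (Pi.single j 1 - monomial (F.deg 0 j) c • w) = 0 := by
    rw [map_sub, map_smul, hc, hw, smul_quotient_mk,
      monomial_mul, add_zero, mul_one, sub_self]
  obtain ⟨v, hv⟩ := (F.exact_zero _).1 h0
  have h1 := constantCoeff_diff F 0 v j
  rw [hv, Pi.sub_apply, map_sub, constantCoeff_monomial_smul hb] at h1
  simp at h1

/-- If the differential of a basis vector of degree `b` is `x^(b - c)` times a boundary,
then `b = c`. -/
lemma deg_eq_of_diff_single_eq (F : MinimalResolution M) (i : ℕ) {j : Fin (F.rank (i + 1))}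
    {c : Fin d →₀ ℕ} (hc : c ≤ F.deg (i + 1) j) {w : Fin (F.rank i) → MvPolynomial (Fin d) k}
    (hw : F.diff i (Pi.single j 1) = monomial (F.deg (i + 1) j - c) (1 : k) • w)
    (hr : w ∈ LinearMap.range (F.diff i)) : F.deg (i + 1) j = c := by
  by_contra hb
  obtain ⟨u, rfl⟩ := hr
  have h0 : F.diff i (Pi.single j 1 - monomial (F.deg (i + 1) j - c) (1 : k) • u) = 0 := by
    rw [map_sub, map_smul, hw, sub_self]
  obtain ⟨v, hv⟩ := (F.exact_succ i _).1 h0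
  have h1 := constantCoeff_diff F (i + 1) v j
  rw [hv, Pi.sub_apply, map_sub, constantCoeff_monomial_smul] at h1
  · simp at h1
  · exact fun h => hb (le_antisymm (tsub_eq_zero_iff_le.1 h) hc)

/-- The multidegrees of a minimal resolution lie in the lcm-lattice. -/
lemma deg_mem_lcmLattice (hM : IsMonomialIdeal M) (F : MinimalResolution M) (i : ℕ)
    (j : Fin (F.rank i)) : F.deg i j ∈ lcmLattice M := by
  induction i with
  | zero =>
    rw [deg_zero_eq hM F j]
    exact ⟨∅, by simp, Finset.sup_empty.symm⟩
  | succ i ih =>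
    -- By induction, degrees in `F_i` below `deg j` are already below `c`, so `d e_j` is divisible
    -- by `x^(deg j - c)`. It remains to see that the quotient `w` is a boundary.
    obtain ⟨c, hcL, hcb, hmax, hmem⟩ := exists_lcm_le M (F.deg (i + 1) j)
    obtain ⟨w, hw, hdw⟩ := (F.diff_degreeZero i _ _
      (isHomogeneousVec_single_one _ j)).exists_eq_monomial_smul hcb fun j' => hmax _ (ih j')
    suffices hr : w ∈ LinearMap.range (F.diff i) by
      rwa [deg_eq_of_diff_single_eq F i hcb hdw hr]
    cases i with
    | zero =>
      -- `R/M` has torsion, so the monomial cannot be cancelled; instead, `x^c` lies in `M` as soon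
      -- as `x^(deg j)` does.
      refine (F.exact_zero w).1 ?_
      obtain ⟨l, hl⟩ := F.aug_degreeZero _ _ hw
      have h0 := F.exact_zero.apply_apply_eq_zero (Pi.single j 1)
      rw [hdw, map_smul, hl, smul_quotient_mk,
        monomial_mul, one_mul, tsub_add_cancel_of_le hcb, Ideal.Quotient.eq_zero_iff_mem] at h0
      rcases eq_or_ne l 0 with rfl | hl0
      · simpa using hl
      · rw [hl, Ideal.Quotient.eq_zero_iff_mem]
        have := M.mul_mem_left (C l) (hmem (monomial_one_mem hl0 h0))
        rwa [C_mul_monomial, mul_one] at this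
    | succ i =>
      refine (F.exact_succ i w).1 ?_
      have h0 := (F.exact_succ i).apply_apply_eq_zero (Pi.single j 1)
      rw [hdw, map_smul] at h0
      -- Here the target is free, so the monomial cancels.
      refine (smul_eq_zero.1 h0).resolve_left ?_
      simp

/-! ### Automorphisms and comparable degrees -/

/-- Every family of degree zero isomorphisms is an automorphism of the resolution. -/
noncomputable def Automorphism.ofEquiv (F : MinimalResolution M)
    (e : ∀ i, (Fin (F.rank i) → MvPolynomial (Fin d) k) ≃ₗ[MvPolynomial (Fin d) k]
      (Fin (F.rank i) → MvPolynomial (Fin d) k))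
    (he : ∀ i, IsDegreeZero (F.deg i) (F.deg i) (e i).toLinearMap)
    (he' : ∀ i, IsDegreeZero (F.deg i) (F.deg i) (e i).symm.toLinearMap) : F.Automorphism where
  toEquiv := e
  degreeZero := he
  comm := by
    -- The second basis is the preimage of the standard one under `e i`; in it the differential has
    -- matrix `e d e⁻¹`.
    refine ⟨⟨fun i => Pi.basisFun _ _, fun i j => ?_⟩,
      ⟨fun i => Module.Basis.ofEquivFun (e i), fun i j => ?_⟩, fun i => ?_⟩
    · rw [Pi.basisFun_apply]
      exact isHomogeneousVec_single_one _ j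
    · rw [Module.Basis.coe_ofEquivFun]
      exact he' i _ _ (isHomogeneousVec_single_one _ j)
    · refine LinearMap.ext fun v => ?_
      have h := LinearMap.toMatrix_mulVec_repr (Module.Basis.ofEquivFun (e (i + 1)))
        (Module.Basis.ofEquivFun (e i)) (F.diff i) v
      have h' := LinearMap.toMatrix_mulVec_repr
        (Pi.basisFun (MvPolynomial (Fin d) k) (Fin (F.rank (i + 1))))
        (Pi.basisFun (MvPolynomial (Fin d) k) (Fin (F.rank i))) (F.diff i) v
      simp only [LinearMap.comp_apply, diffRep, Matrix.toLin'_apply, LinearEquiv.coe_coe]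
      exact h.trans (congrArg (e i) h'.symm)

/-- The map sending the `j`-th basis vector to `x^(deg j - deg j')` times the `j'`-th one, and
the other basis vectors to `0`. -/
noncomputable def elementaryMap {r : ℕ} (a : Fin r → (Fin d →₀ ℕ)) (j j' : Fin r) :
    (Fin r → MvPolynomial (Fin d) k) →ₗ[MvPolynomial (Fin d) k]
      (Fin r → MvPolynomial (Fin d) k) :=
  (LinearMap.proj j).smulRight (Pi.single j' (monomial (a j - a j') (1 : k)))

lemma elementaryMap_comp_self {r : ℕ} (a : Fin r → (Fin d →₀ ℕ)) {j j' : Fin r} (h : j ≠ j')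
    (v : Fin r → MvPolynomial (Fin d) k) :
    elementaryMap a j j' (elementaryMap a j j' v) = 0 := by
  simp [elementaryMap, Pi.single_eq_of_ne h]

lemma isDegreeZero_elementaryMap {r : ℕ} {a : Fin r → (Fin d →₀ ℕ)} {j j' : Fin r}
    (h : a j' ≤ a j) : IsDegreeZero a a (elementaryMap (k := k) a j j') := by
  refine isDegreeZero_of_single _ fun i => ?_
  rcases eq_or_ne j i with rfl | hi
  · have := isHomogeneousVec_single a j' (a j - a j') (1 : k)
    rw [add_tsub_cancel_of_le h] at this
    simpa [elementaryMap] using this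
  · intro l m hm
    simp [elementaryMap, Pi.single_eq_of_ne hi] at hm

/-- The transvection `id + elementaryMap`. -/
noncomputable def elementaryEquiv {r : ℕ} (a : Fin r → (Fin d →₀ ℕ)) {j j' : Fin r}
    (h : j ≠ j') : (Fin r → MvPolynomial (Fin d) k) ≃ₗ[MvPolynomial (Fin d) k]
      (Fin r → MvPolynomial (Fin d) k) :=
  LinearEquiv.ofLinearMap (LinearMap.id + elementaryMap a j j')
    (LinearMap.id - elementaryMap a j j')
    (LinearMap.ext fun v => by simp [elementaryMap_comp_self a h])
    (LinearMap.ext fun v => by simp [elementaryMap_comp_self a h])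

/-- A transvection in homological degree `i`, with the identity elsewhere, has a nonzero
off-diagonal entry. -/
lemma eq_of_deg_le {F : MinimalResolution M} (hF : ∀ f : F.Automorphism, f.IsTrivial) {i : ℕ}
    {j j' : Fin (F.rank i)} (hle : F.deg i j' ≤ F.deg i j) : j = j' := by
  classical
  by_contra hne
  have hE := isDegreeZero_elementaryMap (k := k) hle
  let e : ∀ i, (Fin (F.rank i) → MvPolynomial (Fin d) k) ≃ₗ[MvPolynomial (Fin d) k]
      (Fin (F.rank i) → MvPolynomial (Fin d) k) :=
    Function.update (fun i => LinearEquiv.refl _ _) i (elementaryEquiv (F.deg i) hne)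
  have hei : e i = elementaryEquiv (F.deg i) hne := Function.update_self ..
  have hen : ∀ l, l ≠ i → e l = LinearEquiv.refl _ _ := fun l hl => Function.update_of_ne hl ..
  let f := Automorphism.ofEquiv F e
    (fun l => by
      rcases eq_or_ne l i with rfl | hl
      · rw [hei]
        exact fun b v hv => hv.add (hE b v hv)
      · rw [hen l hl]
        exact fun b v hv => hv)
    (fun l => by
      rcases eq_or_ne l i with rfl | hl
      · rw [hei]
        intro b v hv
        have := hv.add (hE b v hv).neg
        rw [← sub_eq_add_neg] at this
        exact this
      · rw [hen l hl]
        exact fun b v hv => hv)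
  obtain ⟨u, hu⟩ := hF f i
  have h1 := congrFun (congrFun hu j') j
  rw [Matrix.diagonal_apply_ne _ (Ne.symm hne), LinearMap.toMatrix'_apply] at h1
  have h2 : (f.toEquiv i) = elementaryEquiv (F.deg i) hne := hei
  rw [h2] at h1
  simp [elementaryEquiv, elementaryMap, Ne.symm hne] at h1

/-- A monomial `x^m` in entry `(j', j)` forces `deg j' + m = deg j`, hence `j' = j` and `m = 0`.
Injectivity makes the diagonal constants units. -/
lemma Automorphism.isTrivial_of_deg {F : MinimalResolution M}
    (hF : ∀ i (j j' : Fin (F.rank i)), F.deg i j' ≤ F.deg i j → j = j') (f : F.Automorphism) :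
    f.IsTrivial := by
  classical
  intro i
  have hsupp : ∀ j j' m, m ∈ (f.toEquiv i (Pi.single j 1) j').support → j = j' ∧ m = 0 := by
    intro j j' m hm
    have h := f.degreeZero i _ _ (isHomogeneousVec_single_one _ j) j' m hm
    have hj := hF i j j' (h ▸ le_self_add)
    subst hj
    exact ⟨rfl, by simpa using h⟩
  have hdiag : ∀ j, f.toEquiv i (Pi.single j 1) =
      Pi.single j (C (coeff 0 (f.toEquiv i (Pi.single j 1) j))) := by
    intro j
    ext j' m
    rcases eq_or_ne j' j with rfl | hj
    · rw [Pi.single_eq_same, coeff_C]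
      split_ifs with hm
      · rw [hm]
      · by_contra hc
        exact hm (hsupp _ _ m (mem_support_iff.2 hc)).2.symm
    · rw [Pi.single_eq_of_ne hj, coeff_zero]
      by_contra hc
      exact hj (hsupp _ _ m (mem_support_iff.2 hc)).1.symm
  have hne : ∀ j, coeff 0 (f.toEquiv i (Pi.single j 1) j) ≠ 0 := by
    intro j h0
    have h1 := hdiag j
    rw [h0, C_0, Pi.single_zero, LinearEquiv.map_eq_zero_iff, Pi.single_eq_zero_iff] at h1
    exact one_ne_zero h1
  refine ⟨fun j => Units.mk0 _ (hne j), ?_⟩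
  ext1 j' j
  rw [LinearMap.toMatrix'_apply]
  have h2 : (f.toEquiv i).toLinearMap (Pi.single j 1) = f.toEquiv i (Pi.single j 1) := rfl
  rw [h2, hdiag j, Matrix.diagonal_apply]
  rcases eq_or_ne j' j with rfl | hj
  · simp
  · simp [hj]

end MinimalResolution

open MinimalResolution in
theorem proposition1p3 {k : Type*} [Field k] {d : ℕ} (M : Ideal (MvPolynomial (Fin d) k))
    (hM : IsMonomialIdeal M) (F : MinimalResolution M) :
    (∀ f : F.Automorphism, f.IsTrivial) ↔ IsRigid M := by
  classical
  have hmem : ∀ i b, F.rankInDegree i b = 1 → ∃ j, F.deg i j = b := by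
    intro i b h
    obtain ⟨j, hj⟩ := Finset.card_pos.1 (h.symm ▸ Nat.one_pos)
    exact ⟨j, (Finset.mem_filter.1 hj).2⟩
  constructor
  · intro hF
    refine ⟨hM, fun i b => ?_, fun i b b' hbb hb hb' => ?_⟩
    · rw [multigradedBetti_eq_rankInDegree hM F]
      have : F.rankInDegree i b ≤ 1 := by
        -- Equal degrees are in particular comparable.
        refine Finset.card_le_one.2 fun j hj j' hj' => eq_of_deg_le hF ?_
        rw [(Finset.mem_filter.1 hj).2, (Finset.mem_filter.1 hj').2]
      omega
    · rw [multigradedBetti_eq_rankInDegree hM F] at hb hb'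
      obtain ⟨j, hj⟩ := hmem i _ hb
      obtain ⟨j', hj'⟩ := hmem i _ hb'
      have hne : j ≠ j' := fun h => hbb (Subtype.ext (by rw [← hj, ← hj', h]))
      refine ⟨fun h => hne (eq_of_deg_le hF ?_).symm, fun h => hne (eq_of_deg_le hF ?_)⟩
      · rw [hj, hj']; exact h
      · rw [hj, hj']; exact h
  · intro hR f
    refine f.isTrivial_of_deg fun i j j' hle => ?_
    have hle1 : ∀ b, F.rankInDegree i b ≤ 1 := fun b => by
      have := hR.betti_le_one i b
      rw [multigradedBetti_eq_rankInDegree hM F] at this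
      omega
    have hone : ∀ j, multigradedBetti M i (F.deg i j) = 1 := fun j => by
      rw [multigradedBetti_eq_rankInDegree hM F]
      exact le_antisymm (hle1 _) (Finset.card_pos.2 ⟨j, by simp⟩)
    by_cases hd : F.deg i j = F.deg i j'
    · exact Finset.card_le_one.1 (hle1 (F.deg i j)) j (by simp) j' (by simp [hd])
    · exact absurd hle (hR.incomparable i ⟨_, deg_mem_lcmLattice hM F i j⟩
        ⟨_, deg_mem_lcmLattice hM F i j'⟩ (fun h => hd (congrArg Subtype.val h))
        (hone j) (hone j')).2
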